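/- Let $N,m\in\mathbb N$ and $V=\{1,\dots,N\}$. For $t\ge 0$ let $G_{\sigma(t)}=(V,E_{\sigma(t)})$ be a time-varying digraph, where $\sigma$ is piecewise constant (continuous from the right), with values in the finite set of digraphs on $V$, and with a positive lower bound on the distance between consecutive switching instants. Write $\mathcal N_i(\sigma(t))=\{j:(j,i)\in E_{\sigma(t)}\}$. Let $K>0$, and let the weights $a_{ij}(t)$ be measurable in $t$ with $a_*\le a_{ij}(t)\le a^*$ for some constants $0<a_*\le a^*$. Consider the system $$\dot x_i(t)=f_i(x_i(t))+K\sum_{j\in\mathcal N_i(\sigma(t))}a_{ij}(t)\,\bigl(x_j(t)-x_i(t)\bigr),\qquad i=1,\dots,N,\qquad x_i(t)\in\mathbb R^m,$$ whose trajectories are understood as Carathéodory solutions: absolutely continuous on compact time intervals, with the equations holding at almost every time. Assume: - (A1) for every $i$ there is a convex $C^1$ function $F_i:\mathbb R^m\to\mathbb R$ with $\arg\min F_i\ne\emptyset$ and $f_i=-\nabla F_i$; - $G_{\sigma(t)}$ is uniformly jointly strongly connected: there is $T>0$ such that for every $t\ge 0$ the digraph $\bigl(V,\bigcup_{s\in[t,t+T)}E_{\sigma(s)}\bigr)$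 is strongly connected; - the set $Z=\bigcap_{i=1}^N\{z\in\mathbb R^m: f_i(z)=0\}$ has an interior point. Then from every initial value $x^0\in(\mathbb R^m)^N$ there is a trajectory on $[0,\infty)$, and every trajectory on a bounded interval $[0,b)$ extends to one on $[0,\infty)$. Global synchronization is achieved: $\lim_{t\to\infty}|x_i(t)-x_j(t)|=0$ for all $i,j$ along every trajectory on $[0,\infty)$. In fact, for every trajectory on $[0,\infty)$ there is a point $x_*\in Z$ such that $\lim_{t\to\infty}x_i(t)=x_*$ for all $i\in V$. -/

import Mathlib

open Set Filter Topology MeasureTheory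

/-- The joint digraph of the switching digraph `G` over the time set `I`: the union of all arcs that
are present at some time in `I`. -/
def jointDigraph {V : Type*} (G : ℝ → Digraph V) (I : Set ℝ) : Digraph V where
  Adj i j := ∃ t ∈ I, (G t).Adj i j

/-- A digraph is strongly connected if every node is reached from every node along arcs. -/
def StronglyConnected {V : Type*} (D : Digraph V) : Prop :=
  ∀ i j : V, Relation.ReflTransGen D.Adj i j

/-- There is `T > 0` such that the joint digraph over `[t, t + T)` is strongly connected for every
`t ≥ 0`. -/
def UniformlyJointlyStronglyConnected {V : Type*} (G : ℝ → Digraph V) : Prop :=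
  ∃ T : ℝ, 0 < T ∧ ∀ t : ℝ, 0 ≤ t → StronglyConnected (jointDigraph G (Ico t (t + T)))

/-- The switching signal `t ↦ G t`, `t ≥ 0`, is piecewise constant (continuous from the right), with
a positive lower bound `τ` on the distance between consecutive switching instants. Listing the
endpoints of the intervals of constancy as `0 = s 0 < s 1 < s 2 < ⋯` allows times at which no
actual change takes place, so that signals with finitely many switches are included. -/
def PiecewiseConstantWithDwellTime {V : Type*} (G : ℝ → Digraph V) : Prop :=
  ∃ τ : ℝ, 0 < τ ∧ ∃ s : ℕ → ℝ, s 0 = 0 ∧ (∀ k, s k + τ ≤ s (k + 1)) ∧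
    ∀ k, ∀ t ∈ Ico (s k) (s (k + 1)), G t = G (s k)

/-- Admissible arc weights: `a i j` is a measurable function of time `t ≥ 0`, and the weights of the
arcs `(j, i)` present at time `t` lie between two positive constants. -/
def AdmissibleWeights {N : ℕ} (G : ℝ → Digraph (Fin N)) (a : Fin N → Fin N → ℝ → ℝ) : Prop :=
  (∀ i j, AEMeasurable (a i j) (volume.restrict (Ici 0))) ∧
    ∃ aLow aUp : ℝ, 0 < aLow ∧ ∀ i j t, 0 ≤ t → (G t).Adj j i → aLow ≤ a i j t ∧ a i j t ≤ aUp

/-- Each self-dynamics `f i` is minus the gradient of a `C¹` convex function on `ℝᵐ` that attains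
its minimum. -/
def IsConvexGradientDynamics {N m : ℕ}
    (f : Fin N → EuclideanSpace ℝ (Fin m) → EuclideanSpace ℝ (Fin m)) : Prop :=
  ∃ F : Fin N → EuclideanSpace ℝ (Fin m) → ℝ, ∀ i,
    ContDiff ℝ 1 (F i) ∧ ConvexOn ℝ univ (F i) ∧ (∃ z, IsMinOn (F i) univ z) ∧
      ∀ z, f i z = -gradient (F i) z

open Classical in
/-- The right-hand side of the dynamics of node `i` at time `t` in the configuration `y`:
`f i (y i) + K * ∑ a i j t * (y j - y i)`, the sum being over the neighbours `j` of `i` at time `t`,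
that is, those with an arc from `j` to `i` (a self-loop would contribute `0`). -/
noncomputable def couplingField {N m : ℕ}
    (f : Fin N → EuclideanSpace ℝ (Fin m) → EuclideanSpace ℝ (Fin m)) (K : ℝ)
    (G : ℝ → Digraph (Fin N)) (a : Fin N → Fin N → ℝ → ℝ)
    (t : ℝ) (y : Fin N → EuclideanSpace ℝ (Fin m)) (i : Fin N) : EuclideanSpace ℝ (Fin m) :=
  f i (y i) + K • ∑ j ∈ Finset.univ.filter (fun j => (G t).Adj j i), a i j t • (y j - y i)

/-- `x` is a Carathéodory solution of the network dynamics on the time interval `J`, which is meant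
to be `[0, ∞)` or `[0, b)`: every `x i` is absolutely continuous on every compact interval `[0, T]`
inside `J`, and the differential equations hold at almost every time in `J`. -/
def IsCaratheodorySolution {N m : ℕ}
    (f : Fin N → EuclideanSpace ℝ (Fin m) → EuclideanSpace ℝ (Fin m)) (K : ℝ)
    (G : ℝ → Digraph (Fin N)) (a : Fin N → Fin N → ℝ → ℝ)
    (J : Set ℝ) (x : Fin N → ℝ → EuclideanSpace ℝ (Fin m)) : Prop :=
  (∀ T ∈ J, ∀ i, AbsolutelyContinuousOnInterval (x i) 0 T) ∧
    ∀ᵐ t ∂(volume.restrict J), ∀ i,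
      HasDerivAt (x i) (couplingField f K G a t (fun j => x j t) i) t

/-- Along every trajectory, all the distances between node states tend to `0`. -/
def GloballySynchronizes {N m : ℕ}
    (f : Fin N → EuclideanSpace ℝ (Fin m) → EuclideanSpace ℝ (Fin m)) (K : ℝ)
    (G : ℝ → Digraph (Fin N)) (a : Fin N → Fin N → ℝ → ℝ) : Prop :=
  ∀ x : Fin N → ℝ → EuclideanSpace ℝ (Fin m), IsCaratheodorySolution f K G a (Ici 0) x →
    ∀ i j, Tendsto (fun t => ‖x i t - x j t‖) atTop (𝓝 0)

/-!
Let `z` be a common zero of the `f i`, and let `b i j` be `K * a i j` while the arc `(j, i)` is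
present and `0` otherwise. By convexity `f i` never points away from `z`, so the squared distances
`v i = ‖x i - z‖ ^ 2` satisfy `v i' ≤ ∑ j, b i j * (v j - v i)` almost everywhere
(`isConsensusSubsolution_norm_sub_sq`). Everything rests on this scalar inequality.

*Consensus of the distances.* If `M` bounds the `v i` at time `t₀` and `B` bounds the row sums of
`b`, then `u i = exp (B (t - t₀)) * (M - v i)` is nonnegative, nondecreasing, and satisfies
`u i' ≥ b i j * u j`. So a gap below the maximum at one node spreads along arcs, and joint strong
connectivity together with the dwell time spreads it to one more node in each time window, at the
cost of a fixed factor. Hence the maximum of the `v i` would drop below its limit unless all the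
`v i` had that same limit (`exists_tendsto_of_consensusSubsolution`).

*Convergence of the states.* The limit of `‖x i - z‖` is thus independent of `i`, for every common
zero `z`. Since these `z` fill a ball, and a point is determined by its distances to the points of a
ball, all the bounded curves `x i` have one and the same cluster point, to which they converge
(`exists_common_tendsto`). Their velocities are then asymptotic to `f i` at the limit, which must
therefore be a zero of every `f i` (`eq_zero_of_tendsto`). Synchronization is a consequence.

*Existence and extension.* A bounded Carathéodory field has solutions, obtained as limits of Euler
polygons (`exists_caratheodory_solution`). The network field becomes bounded when it is composed
with the radial retraction onto a ball around `z`, and that ball remains invariant, so the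
retraction never acts (`exists_network_solution`). A solution on `[0, T)` is bounded by the maximum
principle, hence Lipschitz, and is continued from its limit at `T` (`exists_network_extension`).
-/

/-! ### Absolutely continuous functions -/

theorem AbsolutelyContinuousOnInterval.of_dist_le {X Y : Type*} [PseudoMetricSpace X]
    [PseudoMetricSpace Y] {f : ℝ → X} {g : ℝ → Y} {a b C : ℝ}
    (hf : AbsolutelyContinuousOnInterval f a b)
    (h : ∀ s ∈ uIcc a b, ∀ t ∈ uIcc a b, dist (g s) (g t) ≤ C * dist (f s) (f t)) :
    AbsolutelyContinuousOnInterval g a b := by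
  rw [absolutelyContinuousOnInterval_iff] at hf ⊢
  intro ε hε
  have hC : 0 < |C| + 1 := by positivity
  obtain ⟨δ, hδ, H⟩ := hf (ε / (|C| + 1)) (by positivity)
  refine ⟨δ, hδ, fun E hE hl => ?_⟩
  have h1 := H E hE hl
  have h2 : ∑ i ∈ Finset.range E.1, dist (g (E.2 i).1) (g (E.2 i).2) ≤
      ∑ i ∈ Finset.range E.1, (|C| + 1) * dist (f (E.2 i).1) (f (E.2 i).2) := by
    refine Finset.sum_le_sum fun i hi => (h _ (hE.1 i hi).1 _ (hE.1 i hi).2).trans ?_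
    gcongr
    linarith [le_abs_self C]
  rw [← Finset.mul_sum] at h2
  refine h2.trans_lt ?_
  rwa [lt_div_iff₀' hC] at h1

theorem AbsolutelyContinuousOnInterval.inner_const {E : Type*} [NormedAddCommGroup E]
    [InnerProductSpace ℝ E] {f : ℝ → E} {a b : ℝ} (hf : AbsolutelyContinuousOnInterval f a b)
    (e : E) : AbsolutelyContinuousOnInterval (fun t => inner ℝ e (f t)) a b := by
  refine hf.of_dist_le (C := ‖e‖) fun s _ t _ => ?_
  rw [Real.dist_eq, dist_eq_norm, ← inner_sub_right]
  exact abs_real_inner_le_norm _ _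

theorem AbsolutelyContinuousOnInterval.norm_sub_sq {E : Type*} [NormedAddCommGroup E]
    [InnerProductSpace ℝ E] {f : ℝ → E} {a b : ℝ} (hf : AbsolutelyContinuousOnInterval f a b)
    (z : E) : AbsolutelyContinuousOnInterval (fun t => ‖f t - z‖ ^ 2) a b := by
  have h1 : AbsolutelyContinuousOnInterval (fun t => ‖f t - z‖) a b := by
    refine hf.of_dist_le (C := 1) fun s _ t _ => ?_
    rw [Real.dist_eq, dist_eq_norm, one_mul]
    simpa using abs_norm_sub_norm_le (f s - z) (f t - z)
  simp only [sq]
  exact h1.mul h1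

/-- An absolutely continuous function whose derivative is almost everywhere at least `c` has all
its difference quotients at least `c`. -/
theorem AbsolutelyContinuousOnInterval.mul_sub_le_sub {g : ℝ → ℝ} {a b c : ℝ} (hab : a ≤ b)
    (hg : AbsolutelyContinuousOnInterval g a b)
    (h : ∀ᵐ t, t ∈ Ioo a b → ∃ d, HasDerivAt g d t ∧ c ≤ d) :
    c * (b - a) ≤ g b - g a := by
  rw [← hg.integral_deriv_eq_sub, mul_comm]
  have h0 : ∫ _ in a..b, c = (b - a) * c := by simp
  rw [← h0]
  refine intervalIntegral.integral_mono_ae_restrict hab (by simp) hg.intervalIntegrable_deriv ?_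
  rw [← restrict_Ioo_eq_restrict_Icc]
  filter_upwards [ae_restrict_of_ae h, self_mem_ae_restrict measurableSet_Ioo] with t ht hm
  obtain ⟨d, hd, hc⟩ := ht hm
  rwa [hd.deriv]

theorem AbsolutelyContinuousOnInterval.norm_sub_le {E : Type*} [NormedAddCommGroup E]
    [InnerProductSpace ℝ E] {x : ℝ → E} {a b C : ℝ} (hab : a ≤ b)
    (hC₀ : 0 ≤ C) (hx : AbsolutelyContinuousOnInterval x a b)
    (h : ∀ᵐ t, t ∈ Ioo a b → ∃ d, HasDerivAt x d t ∧ ‖d‖ ≤ C) : ‖x b - x a‖ ≤ C * (b - a) := by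
  set e := x b - x a with he
  have key := (hx.inner_const (-e)).mul_sub_le_sub (c := -(‖e‖ * C)) hab (by
    filter_upwards [h] with t ht hm
    obtain ⟨d, hd, hC⟩ := ht hm
    refine ⟨inner ℝ (-e) d, ?_, ?_⟩
    · exact (innerSL ℝ (-e)).hasFDerivAt.comp_hasDerivAt t hd
    · rw [inner_neg_left, neg_le_neg_iff]
      exact (real_inner_le_norm _ _).trans (by gcongr))
  rw [← inner_sub_right, ← he, inner_neg_left, real_inner_self_eq_norm_sq] at key
  rcases (norm_nonneg e).eq_or_lt with h0 | h0
  · rw [← h0]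
    exact mul_nonneg hC₀ (sub_nonneg.2 hab)
  · nlinarith

/-- Barrier: an absolutely continuous function that decreases while it is at or above a level stays
below that level. -/
theorem AbsolutelyContinuousOnInterval.le_of_deriv_nonpos_of_ge {φ : ℝ → ℝ} {a b M : ℝ}
    (hab : a ≤ b) (hφ : AbsolutelyContinuousOnInterval φ a b) (ha : φ a ≤ M)
    (h : ∀ᵐ t, t ∈ Ioo a b → M ≤ φ t → ∃ d, HasDerivAt φ d t ∧ d ≤ 0) : φ b ≤ M := by
  by_contra! hb
  have hcont := hφ.continuousOn
  rw [uIcc_of_le hab] at hcont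
  have hcpt : IsCompact {t ∈ Icc a b | φ t ≤ M} := by
    refine isCompact_Icc.of_isClosed_subset ?_ (fun t ht => ht.1)
    exact hcont.preimage_isClosed_of_isClosed isClosed_Icc isClosed_Iic
  obtain ⟨s, ⟨hs, hsM⟩, hgr⟩ := hcpt.exists_isGreatest ⟨a, ⟨le_rfl, hab⟩, ha⟩
  have hac : AbsolutelyContinuousOnInterval φ s b := hφ.mono (by
    rw [uIcc_of_le hs.2, uIcc_of_le hab]; exact Icc_subset_Icc hs.1 le_rfl)
  have key := hac.neg.mul_sub_le_sub (c := 0) hs.2 (by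
    filter_upwards [h] with t ht hm
    have hlt : M < φ t := by
      by_contra! hle
      exact (hgr ⟨⟨hs.1.trans hm.1.le, hm.2.le⟩, hle⟩).not_gt hm.1
    obtain ⟨d, hd, hd0⟩ := ht ⟨hs.1.trans_lt hm.1, hm.2⟩ hlt.le
    exact ⟨-d, hd.neg, by linarith⟩)
  simp only [Pi.neg_apply] at key
  linarith

/-! ### The scalar consensus inequality -/

/-- The scalar differential inequality `v i' ≤ ∑ j, b i j * (v j - v i)` satisfied almost everywhere
on the interval `(t₀, t₁)` by absolutely continuous functions `v i`. -/
structure IsConsensusSubsolution {ι : Type*} [Fintype ι] (b : ι → ι → ℝ → ℝ) (t₀ t₁ : ℝ)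
    (v : ι → ℝ → ℝ) : Prop where
  ac : ∀ i, AbsolutelyContinuousOnInterval (v i) t₀ t₁
  deriv_le : ∀ᵐ t, t ∈ Ioo t₀ t₁ → ∀ i, ∃ d, HasDerivAt (v i) d t ∧
    d ≤ ∑ j, b i j t * (v j t - v i t)

/-- Nonnegative weights all of whose row sums are at most `B`. -/
structure IsBoundedWeights {ι : Type*} [Fintype ι] (b : ι → ι → ℝ → ℝ) (B : ℝ) : Prop where
  nonneg : ∀ i j t, 0 ≤ b i j t
  sum_le : ∀ i t, ∑ j, b i j t ≤ B
  bound_nonneg : 0 ≤ B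

section Scalar

variable {ι : Type*} [Fintype ι] {b : ι → ι → ℝ → ℝ} {B t₀ t₁ : ℝ} {v : ι → ℝ → ℝ}

theorem IsConsensusSubsolution.mono (h : IsConsensusSubsolution b t₀ t₁ v) {s₀ s₁ : ℝ}
    (h₀ : t₀ ≤ s₀) (h₀₁ : s₀ ≤ s₁) (h₁ : s₁ ≤ t₁) : IsConsensusSubsolution b s₀ s₁ v where
  ac i := (h.ac i).mono (by
    rw [uIcc_of_le h₀₁, uIcc_of_le (by linarith)]; exact Icc_subset_Icc h₀ h₁)
  deriv_le := by
    filter_upwards [h.deriv_le] with t ht hm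
    exact ht ⟨by linarith [hm.1], by linarith [hm.2]⟩

theorem absolutelyContinuousOnInterval_exp_mul (c a₀ a b : ℝ) :
    AbsolutelyContinuousOnInterval (fun t => Real.exp (c * (t - a₀))) a b :=
  ContDiffOn.absolutelyContinuousOnInterval (by fun_prop)

/-- The gap `M - v i` to a level `M`, weighted by `exp (B t)`, absorbs the outgoing terms of the
inequality: what remains on the right is a sum of gaps with nonnegative coefficients. -/
theorem IsConsensusSubsolution.exp_mul_gap_deriv (h : IsConsensusSubsolution b t₀ t₁ v)
    (a₀ M B : ℝ) : ∀ᵐ t, t ∈ Ioo t₀ t₁ → ∀ i, ∃ d,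
      HasDerivAt (fun t => Real.exp (B * (t - a₀)) * (M - v i t)) d t ∧
      Real.exp (B * (t - a₀)) *
        ((B - ∑ j, b i j t) * (M - v i t) + ∑ j, b i j t * (M - v j t)) ≤ d := by
  filter_upwards [h.deriv_le] with t ht hm i
  obtain ⟨d, hd, hle⟩ := ht hm i
  have h1 : HasDerivAt (fun t => Real.exp (B * (t - a₀))) (Real.exp (B * (t - a₀)) * (B * 1)) t :=
    (((hasDerivAt_id t).sub_const a₀).const_mul B).exp
  refine ⟨_, h1.mul (hd.const_sub M), ?_⟩
  have h2 : ∑ j, b i j t * (v j t - v i t) =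
      (∑ j, b i j t) * (M - v i t) - ∑ j, b i j t * (M - v j t) := by
    rw [Finset.sum_mul, ← Finset.sum_sub_distrib]
    exact Finset.sum_congr rfl fun j _ => by ring
  rw [h2] at hle
  have h3 := Real.exp_pos (B * (t - a₀))
  nlinarith

/-- Maximum principle: a level that bounds all the `v i` at the initial time bounds them later.
If the least value `-μ` of `exp (-B t) * (M - v i t)` were negative, attained at `(i, t)`, then
`exp (B s) * (M - v i s) + μ / 2 * exp (2 B s)` would be nondecreasing on `[t₀, t]`, positive at
`t₀` and negative at `t`. -/
theorem IsConsensusSubsolution.le_of_le (h : IsConsensusSubsolution b t₀ t₁ v)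
    (hb : IsBoundedWeights b B) {M : ℝ} (hM : ∀ i, v i t₀ ≤ M) {t : ℝ} (ht : t ∈ Icc t₀ t₁)
    (i : ι) : v i t ≤ M := by
  have : Nonempty ι := ⟨i⟩
  have h01 : t₀ ≤ t₁ := ht.1.trans ht.2
  have hcont : ∀ k, ContinuousOn (fun s => Real.exp (-(B * (s - t₀))) * (M - v k s))
      (Icc t₀ t₁) := by
    intro k
    have := (h.ac k).continuousOn
    rw [uIcc_of_le h01] at this
    fun_prop
  choose r hr hmin using fun k => isCompact_Icc.exists_isMinOn ⟨t, ht⟩ (hcont k)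
  obtain ⟨k, -, hk⟩ := Finset.exists_min_image Finset.univ
    (fun k => Real.exp (-(B * (r k - t₀))) * (M - v k (r k))) ⟨i, Finset.mem_univ i⟩
  set μ := -(Real.exp (-(B * (r k - t₀))) * (M - v k (r k))) with hμ
  have hall : ∀ j, ∀ s ∈ Icc t₀ t₁, -μ * Real.exp (B * (s - t₀)) ≤ M - v j s := by
    intro j s hs
    have h1 := (hk j (Finset.mem_univ j)).trans (hmin j hs)
    have h2 : Real.exp (-(B * (s - t₀))) * (M - v j s) * Real.exp (B * (s - t₀)) = M - v j s := by
      rw [mul_right_comm, ← Real.exp_add]; simp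
    rw [← h2, hμ, neg_neg]
    gcongr
  rcases le_or_gt μ 0 with hneg | hpos
  · have h1 := hall i t ht
    have h2 := Real.exp_pos (B * (t - t₀))
    nlinarith
  exfalso
  have hsub := h.mono le_rfl (hr k).1 (hr k).2
  have hac : AbsolutelyContinuousOnInterval (fun s => Real.exp (B * (s - t₀)) * (M - v k s)
      + μ / 2 * Real.exp (2 * B * (s - t₀))) t₀ (r k) := by
    refine .add (.mul (absolutelyContinuousOnInterval_exp_mul _ _ _ _) (.sub ?_ (hsub.ac k)))
      (.const_mul _ (absolutelyContinuousOnInterval_exp_mul _ _ _ _))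
    exact ContDiffOn.absolutelyContinuousOnInterval contDiffOn_const
  have key := hac.mul_sub_le_sub (c := 0) (hr k).1 (by
    filter_upwards [hsub.exp_mul_gap_deriv t₀ M B] with s hs hm
    obtain ⟨d, hd, hle⟩ := hs hm k
    have hmI : s ∈ Icc t₀ t₁ := ⟨hm.1.le, hm.2.le.trans (hr k).2⟩
    have h1 : HasDerivAt (fun s => Real.exp (2 * B * (s - t₀)))
        (Real.exp (2 * B * (s - t₀)) * (2 * B * 1)) s :=
      (((hasDerivAt_id s).sub_const t₀).const_mul (2 * B)).exp
    refine ⟨_, hd.add (h1.const_mul (μ / 2)), ?_⟩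
    have he : Real.exp (2 * B * (s - t₀)) = Real.exp (B * (s - t₀)) * Real.exp (B * (s - t₀)) := by
      rw [← Real.exp_add]; ring_nf
    have h2 : (∑ j, b k j s) * (-μ * Real.exp (B * (s - t₀))) ≤ ∑ j, b k j s * (M - v j s) := by
      rw [Finset.sum_mul]
      exact Finset.sum_le_sum fun j _ => mul_le_mul_of_nonneg_left (hall j s hmI) (hb.nonneg k j s)
    have h3 := mul_le_mul_of_nonneg_left (hall k s hmI) (sub_nonneg.2 (hb.sum_le k s))
    have h4 := mul_le_mul_of_nonneg_left (add_le_add h3 h2) (Real.exp_pos (B * (s - t₀))).le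
    rw [he]
    nlinarith)
  have h0 : 0 ≤ M - v k t₀ := by linarith [hM k]
  have h5 : M - v k (r k) = -μ * Real.exp (B * (r k - t₀)) := by
    rw [hμ, neg_neg, mul_right_comm, ← Real.exp_add]; simp
  have he : Real.exp (2 * B * (r k - t₀)) =
      Real.exp (B * (r k - t₀)) * Real.exp (B * (r k - t₀)) := by
    rw [← Real.exp_add]; ring_nf
  simp only [h5, he, sub_self, mul_zero, Real.exp_zero] at key
  have := Real.exp_pos (B * (r k - t₀))
  have : 0 < μ * (Real.exp (B * (r k - t₀)) * Real.exp (B * (r k - t₀))) := by positivity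
  nlinarith

/-- The weighted gaps `u i = exp (B (t - t₀)) * (M - v i)` satisfy `u i' ≥ b i j * u j` and are
nonnegative and nondecreasing; so on an interval where `b i j ≥ c` the gap at `j` feeds that at
`i`. -/
theorem IsConsensusSubsolution.exp_mul_gap_add_le (h : IsConsensusSubsolution b t₀ t₁ v)
    (hb : IsBoundedWeights b B) {M : ℝ} (hM : ∀ i, v i t₀ ≤ M) {s t c : ℝ} (hs : t₀ ≤ s)
    (hst : s ≤ t) (ht : t ≤ t₁) (hc : 0 ≤ c) (i j : ι) (hbc : ∀ r ∈ Ioo s t, c ≤ b i j r)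
    {w : ℝ} (hw : ∀ r ∈ Ioo s t, w ≤ Real.exp (B * (r - t₀)) * (M - v j r)) :
    Real.exp (B * (s - t₀)) * (M - v i s) + c * w * (t - s) ≤
      Real.exp (B * (t - t₀)) * (M - v i t) := by
  have hsub := h.mono hs hst ht
  have hac : AbsolutelyContinuousOnInterval (fun r => Real.exp (B * (r - t₀)) * (M - v i r))
      s t :=
    .mul (absolutelyContinuousOnInterval_exp_mul _ _ _ _)
      (.sub (ContDiffOn.absolutelyContinuousOnInterval contDiffOn_const) (hsub.ac i))
  have key := hac.mul_sub_le_sub (c := c * w) hst (by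
    filter_upwards [hsub.exp_mul_gap_deriv t₀ M B] with r hr hm
    obtain ⟨d, hd, hle⟩ := hr hm i
    refine ⟨d, hd, le_trans ?_ hle⟩
    have hgap : ∀ k, 0 ≤ M - v k r := fun k => by
      linarith [h.le_of_le hb hM (t := r) ⟨by linarith [hm.1], by linarith [hm.2]⟩ k]
    have h1 : b i j r * (M - v j r) ≤ ∑ j, b i j r * (M - v j r) :=
      Finset.single_le_sum (f := fun j => b i j r * (M - v j r))
        (fun k _ => mul_nonneg (hb.nonneg i k r) (hgap k)) (Finset.mem_univ j)
    have h2 := mul_nonneg (sub_nonneg.2 (hb.sum_le i r)) (hgap i)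
    have h3 := mul_le_mul_of_nonneg_right (hbc r hm) (hgap j)
    have h4 := Real.exp_pos (B * (r - t₀))
    calc c * w ≤ c * (Real.exp (B * (r - t₀)) * (M - v j r)) := by gcongr; exact hw r hm
      _ = Real.exp (B * (r - t₀)) * (c * (M - v j r)) := by ring
      _ ≤ _ := by gcongr; linarith)
  linarith

theorem IsConsensusSubsolution.exp_mul_gap_le (h : IsConsensusSubsolution b t₀ t₁ v)
    (hb : IsBoundedWeights b B) {M : ℝ} (hM : ∀ i, v i t₀ ≤ M) {s t : ℝ} (hs : t₀ ≤ s)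
    (hst : s ≤ t) (ht : t ≤ t₁) (i : ι) :
    Real.exp (B * (s - t₀)) * (M - v i s) ≤ Real.exp (B * (t - t₀)) * (M - v i t) := by
  have := h.exp_mul_gap_add_le hb hM hs hst ht le_rfl i i (fun r _ => hb.nonneg i i r)
    (w := 0) (fun r hr => mul_nonneg (Real.exp_pos _).le (sub_nonneg.2
      (h.le_of_le hb hM ⟨by linarith [hr.1], by linarith [hr.2]⟩ i)))
  simpa using this

/-- Every proper nonempty set `S` of nodes is left, within every time window of length `T`, by an
arc from some `j ∈ S` to some `i ∉ S` whose weight `b i j` is at least `c` during a time interval of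
length `τ`. -/
def PersistentlyLeaving (b : ι → ι → ℝ → ℝ) (T τ c : ℝ) : Prop :=
  ∀ t : ℝ, 0 ≤ t → ∀ S : Finset ι, S.Nonempty → S ≠ Finset.univ →
    ∃ j ∈ S, ∃ i ∉ S, ∃ s, t ≤ s ∧ s + τ ≤ t + T ∧ ∀ r ∈ Ioo s (s + τ), c ≤ b i j r

/-- A gap of size `ε` at one node propagates to one more node in each time window. -/
theorem IsConsensusSubsolution.exists_card_gap {T τ c : ℝ} (hT : 0 ≤ T) (hτ : 0 < τ) (hc : 0 < c)
    (hleave : PersistentlyLeaving b T τ c) (hb : IsBoundedWeights b B) (ht₀ : 0 ≤ t₀)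
    {M ε : ℝ} (hε : 0 ≤ ε) {k : ι} (hk : ε ≤ M - v k t₀) (hM : ∀ i, v i t₀ ≤ M) (n : ℕ)
    (h : IsConsensusSubsolution b t₀ (t₀ + n * T) v) :
    ∃ S : Finset ι, S.Nonempty ∧ (n + 1 ≤ S.card ∨ S = Finset.univ) ∧
      ∀ i ∈ S, (min 1 (c * τ)) ^ n * ε ≤
        Real.exp (B * (t₀ + n * T - t₀)) * (M - v i (t₀ + n * T)) := by
  classical
  induction n with
  | zero => exact ⟨{k}, by simp, by simp, by simpa using hk⟩
  | succ n ih =>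
    have hnT : 0 ≤ n * T := by positivity
    have hend : t₀ + (n + 1 : ℕ) * T = t₀ + n * T + T := by push_cast; ring
    rw [hend] at h ⊢
    obtain ⟨S, hne, hcard, hS⟩ := ih (h.mono le_rfl (by linarith) (by linarith))
    have hγ0 : 0 ≤ min 1 (c * τ) := by positivity
    have hγ1 : min 1 (c * τ) ≤ 1 := min_le_left _ _
    have hγc : min 1 (c * τ) ≤ c * τ := min_le_right _ _
    set γ := min 1 (c * τ)
    have hpow : γ ^ (n + 1) * ε ≤ γ ^ n * ε := by
      gcongr ?_ * ε
      exact pow_le_pow_of_le_one hγ0 hγ1 n.le_succ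
    have hkeep : ∀ i ∈ S, γ ^ (n + 1) * ε ≤
        Real.exp (B * (t₀ + n * T + T - t₀)) * (M - v i (t₀ + n * T + T)) := fun i hi =>
      hpow.trans ((hS i hi).trans
        (h.exp_mul_gap_le hb hM (by linarith) (by linarith) le_rfl i))
    by_cases huniv : S = Finset.univ
    · exact ⟨S, hne, .inr huniv, hkeep⟩
    obtain ⟨j, hj, i, hi, s, hs, hsT, hcs⟩ := hleave (t₀ + n * T) (by positivity) S hne huniv
    refine ⟨insert i S, by simp, .inl ?_, fun l hl => ?_⟩
    · rw [Finset.card_insert_of_notMem hi]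
      have := hcard.resolve_right huniv
      omega
    rcases Finset.mem_insert.1 hl with rfl | hl
    · have h1 := h.exp_mul_gap_add_le hb hM (s := s) (t := s + τ) (by linarith) (by linarith)
        hsT hc.le l j hcs (w := γ ^ n * ε) (fun r hr => (hS j hj).trans
          (h.exp_mul_gap_le hb hM (by linarith) (by linarith [hr.1]) (by linarith [hr.2]) j))
      have h2 := h.exp_mul_gap_le hb hM (s := s + τ) (t := t₀ + n * T + T) (by linarith) hsT
        le_rfl l
      have h3 := h.le_of_le hb hM (t := s) ⟨by linarith, by linarith⟩ l
      have h4 := mul_nonneg (Real.exp_pos (B * (s - t₀))).le (sub_nonneg.2 h3)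
      have h5 : γ ^ (n + 1) * ε ≤ c * (γ ^ n * ε) * τ := by
        have : 0 ≤ γ ^ n * ε := by positivity
        calc γ ^ (n + 1) * ε = γ * (γ ^ n * ε) := by ring
          _ ≤ c * τ * (γ ^ n * ε) := by gcongr
          _ = _ := by ring
      have h6 : s + τ - s = τ := by ring
      rw [h6] at h1
      linarith
    · exact hkeep l hl

/-- A gap of size `ε` at one node becomes, after as many windows as there are nodes, a gap of a fixed
proportion of `ε` at every node. -/
theorem IsConsensusSubsolution.gap_le {T τ c : ℝ} (hT : 0 ≤ T) (hτ : 0 < τ) (hc : 0 < c)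
    (hleave : PersistentlyLeaving b T τ c) (hb : IsBoundedWeights b B) (ht₀ : 0 ≤ t₀)
    {M ε : ℝ} (hε : 0 ≤ ε) {k : ι} (hk : ε ≤ M - v k t₀) (hM : ∀ i, v i t₀ ≤ M)
    (h : IsConsensusSubsolution b t₀ (t₀ + Fintype.card ι * T) v) (i : ι) :
    (Real.exp (B * (Fintype.card ι * T)))⁻¹ * (min 1 (c * τ)) ^ Fintype.card ι * ε ≤
      M - v i (t₀ + Fintype.card ι * T) := by
  obtain ⟨S, -, hcard, hS⟩ := h.exists_card_gap hT hτ hc hleave hb ht₀ hε hk hM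
  have hi : i ∈ S := by
    rcases hcard with hcard | rfl
    · have := S.card_le_univ
      omega
    · exact Finset.mem_univ i
  have := hS i hi
  rw [add_sub_cancel_left] at this
  rw [mul_assoc, inv_mul_le_iff₀ (Real.exp_pos _)]
  exact this

/-- Consensus: nonnegative solutions of the differential inequality over persistently connected
weights all converge to the same limit, namely the limit `L` of their maximum. If some `v k` were
below `L - ε` at a late time, then soon after all the `v i` would be below `L`. -/
theorem exists_tendsto_of_consensusSubsolution [Nonempty ι] {T τ c : ℝ} (hT : 0 ≤ T) (hτ : 0 < τ)
    (hc : 0 < c) (hleave : PersistentlyLeaving b T τ c) (hb : IsBoundedWeights b B)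
    (h : ∀ t, 0 ≤ t → IsConsensusSubsolution b 0 t v) (hv : ∀ i t, 0 ≤ v i t) :
    ∃ L, ∀ i, Tendsto (v i) atTop (𝓝 L) := by
  have hsub : ∀ s t, 0 ≤ s → s ≤ t → IsConsensusSubsolution b s t v := fun s t hs hst =>
    (h t (hs.trans hst)).mono hs hst le_rfl
  set A : Set ℝ := {M | ∃ t, 0 ≤ t ∧ ∀ i, v i t ≤ M} with hA
  have hAne : A.Nonempty :=
    ⟨∑ i, v i 0, 0, le_rfl, fun i => Finset.single_le_sum (f := fun i => v i 0)
      (fun j _ => hv j 0) (Finset.mem_univ i)⟩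
  have hAbdd : BddBelow A := ⟨0, fun M ⟨t, _, hM⟩ =>
    (hv (Classical.arbitrary ι) t).trans (hM _)⟩
  have hlow : ∀ t, 0 ≤ t → ∀ M, (∀ i, v i t ≤ M) → sInf A ≤ M := fun t ht M hM =>
    csInf_le hAbdd ⟨t, ht, hM⟩
  have hupp : ∀ ε > 0, ∃ t, 0 ≤ t ∧ ∀ s, t ≤ s → ∀ i, v i s ≤ sInf A + ε := by
    intro ε hε
    obtain ⟨M, ⟨t, ht, hM⟩, hlt⟩ := exists_lt_of_csInf_lt hAne (lt_add_of_pos_right (sInf A) hε)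
    exact ⟨t, ht, fun s hs i =>
      ((hsub t s ht hs).le_of_le hb hM ⟨hs, le_rfl⟩ i).trans hlt.le⟩
  refine ⟨sInf A, fun i => Metric.tendsto_atTop.2 fun ε hε => ?_⟩
  set η := (Real.exp (B * (Fintype.card ι * T)))⁻¹ * (min 1 (c * τ)) ^ Fintype.card ι with hη
  have hηpos : 0 < η := by positivity
  -- once the maximum is below `L + η * ε / 2`, a gap `ε` at one node would lower it by `η * ε`
  have hδ : 0 < min (ε / 2) (η * ε / 2) := by positivity
  obtain ⟨t, ht, hts⟩ := hupp _ hδ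
  refine ⟨t, fun s hs => ?_⟩
  have h1 := hts s hs i
  have h2 : min (ε / 2) (η * ε / 2) ≤ ε / 2 := min_le_left _ _
  have h3 : min (ε / 2) (η * ε / 2) ≤ η * ε / 2 := min_le_right _ _
  rw [Real.dist_eq, abs_lt]
  refine ⟨?_, by linarith⟩
  by_contra hcon
  have hs0 : 0 ≤ s := ht.trans hs
  have hNT : 0 ≤ (Fintype.card ι : ℝ) * T := by positivity
  have h4 := hlow (s + Fintype.card ι * T) (by positivity)
    (sInf A + min (ε / 2) (η * ε / 2) - η * ε) (fun l => by
      have := (hsub s (s + Fintype.card ι * T) hs0 (by linarith)).gap_le hT hτ hc hleave hb hs0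
        hε.le (M := sInf A + min (ε / 2) (η * ε / 2)) (k := i) (by linarith) (hts s hs) l
      linarith)
  have : 0 < η * ε := by positivity
  linarith

end Scalar

/-! ### Carathéodory's existence theorem -/

theorem intervalIntegrable_of_norm_le {E : Type*} [NormedAddCommGroup E] {φ : ℝ → E} {C : ℝ}
    (hφ : AEStronglyMeasurable φ)
    (hC : ∀ t, ‖φ t‖ ≤ C) (a b : ℝ) : IntervalIntegrable φ volume a b :=
  (intervalIntegrable_const (c := C)).mono_fun hφ.restrict
    (.of_forall fun t => (hC t).trans (le_abs_self C))

theorem exists_subseq_tendsto_of_lipschitz {E : Type*} [NormedAddCommGroup E]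
    [ProperSpace E] {x : ℕ → ℝ → E} {K : NNReal}
    (hx : ∀ n, LipschitzWith K (x n)) {t₀ : ℝ} {x₀ : E} (hx₀ : ∀ n, x n t₀ = x₀) :
    ∃ (φ : ℕ → ℕ) (y : ℝ → E), StrictMono φ ∧ ∀ t, Tendsto (fun n => x (φ n) t) atTop (𝓝 (y t)) := by
  -- compactness of a countable product of balls gives convergence at the rational times
  have hcpt : IsCompact (Set.pi univ fun q : ℚ => Metric.closedBall x₀ (K * dist (q : ℝ) t₀)) :=
    isCompact_univ_pi fun q => isCompact_closedBall _ _
  obtain ⟨c, -, φ, hφ, hc⟩ := hcpt.tendsto_subseq (x := fun n (q : ℚ) => x n q) fun n q _ => by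
    have := (hx n).dist_le_mul q t₀
    rwa [hx₀] at this
  rw [tendsto_pi_nhds] at hc
  have hcau : ∀ t, CauchySeq fun n => x (φ n) t := by
    intro t
    rw [Metric.cauchySeq_iff']
    intro ε hε
    obtain ⟨q, hq⟩ := Rat.denseRange_cast.exists_dist_lt t (ε := ε / (4 * (K + 1))) (by positivity)
    obtain ⟨n₀, hn₀⟩ := Metric.cauchySeq_iff'.1 (hc q).cauchySeq (ε / 2) (by positivity)
    refine ⟨n₀, fun n hn => ?_⟩
    have hK : (K : ℝ) * dist t q ≤ ε / 4 := by
      calc (K : ℝ) * dist t q ≤ (K + 1) * (ε / (4 * (K + 1))) := by gcongr; linarith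
        _ = ε / 4 := by field_simp
    have h1 := (hx (φ n)).dist_le_mul t q
    have h2 := (hx (φ n₀)).dist_le_mul t q
    have h3 := hn₀ n hn
    simp only [Function.comp_apply] at h3
    have h4 := dist_triangle4 (x (φ n) t) (x (φ n) q) (x (φ n₀) q) (x (φ n₀) t)
    rw [dist_comm (x (φ n₀) q)] at h4
    linarith
  choose y hy using fun t => cauchySeq_tendsto_of_complete (hcau t)
  exact ⟨φ, y, hφ, hy⟩

section Peano

variable {E : Type*} [NormedAddCommGroup E] [NormedSpace ℝ E] {g : ℝ → E → E} {C : ℝ}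

/-- The Euler polygon of step `h`: `u` is the step function of its nodes, and the polygon itself
is the integral of the field along `u`. -/
theorem exists_euler_polygon (hmeas : ∀ u : ℝ → E, StronglyMeasurable u →
      AEStronglyMeasurable (fun s => g s (u s)))
    (hC : ∀ s y, ‖g s y‖ ≤ C) (t₀ : ℝ) (x₀ : E) {h : ℝ} (hh : 0 < h) :
    ∃ u : ℝ → E, StronglyMeasurable u ∧
      ∀ t, t₀ ≤ t → ‖u t - (x₀ + ∫ s in t₀..t, g s (u s))‖ ≤ C * h := by
  let p : ℕ → E := fun n => n.rec x₀
    fun k y => y + ∫ s in (t₀ + k * h)..(t₀ + (k + 1 : ℕ) * h), g s y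
  have hp : ∀ k, p (k + 1) = p k + ∫ s in (t₀ + k * h)..(t₀ + (k + 1 : ℕ) * h), g s (p k) :=
    fun k => rfl
  let u : ℝ → E := fun t => p ⌊(t - t₀) / h⌋₊
  have hu : StronglyMeasurable u :=
    (StronglyMeasurable.of_discrete (f := p)).comp_measurable
      (Nat.measurable_floor.comp (by fun_prop))
  have hint : ∀ a b, IntervalIntegrable (fun s => g s (u s)) volume a b :=
    intervalIntegrable_of_norm_le (hmeas u hu) fun s => hC s _
  have hstep : ∀ (k : ℕ) s, s ∈ Ico (t₀ + k * h) (t₀ + (k + 1 : ℕ) * h) → u s = p k := by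
    intro k s hs
    have : ⌊(s - t₀) / h⌋₊ = k := by
      have h1 : t₀ + (k + 1 : ℕ) * h = t₀ + (k + 1) * h := by push_cast; ring
      rw [h1] at hs
      rw [Nat.floor_eq_iff (div_nonneg (by nlinarith [hs.1, k.cast_nonneg (α := ℝ)]) hh.le),
        le_div_iff₀ hh, div_lt_iff₀ hh]
      constructor <;> linarith [hs.1, hs.2]
    simp only [u, this]
  have hnode : ∀ k : ℕ, x₀ + ∫ s in t₀..(t₀ + k * h), g s (u s) = p k := by
    intro k
    induction k with
    | zero => simp [p]
    | succ k ih =>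
      rw [← intervalIntegral.integral_add_adjacent_intervals (hint t₀ (t₀ + k * h)) (hint _ _),
        ← add_assoc, ih, hp]
      congr 1
      have hle : t₀ + k * h ≤ t₀ + (k + 1 : ℕ) * h := by push_cast; nlinarith
      rw [intervalIntegral.integral_of_le hle, intervalIntegral.integral_of_le hle,
        ← integral_Ico_eq_integral_Ioc, ← integral_Ico_eq_integral_Ioc]
      exact setIntegral_congr_fun measurableSet_Ico fun s hs => by
        simp only [hstep k s hs]
  refine ⟨u, hu, fun t ht => ?_⟩
  set k := ⌊(t - t₀) / h⌋₊ with hk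
  have h1 : (k : ℝ) * h ≤ t - t₀ := by
    rw [← le_div_iff₀ hh]
    exact Nat.floor_le (div_nonneg (sub_nonneg.2 ht) hh.le)
  have h2 : t - t₀ < (k + 1) * h := by
    rw [← div_lt_iff₀ hh]
    exact Nat.lt_floor_add_one _
  have hC0 : 0 ≤ C := (norm_nonneg _).trans (hC t x₀)
  rw [← intervalIntegral.integral_add_adjacent_intervals (hint t₀ (t₀ + k * h)) (hint _ _),
    ← add_assoc, hnode]
  have hut : u t = p k := rfl
  rw [hut, sub_add_cancel_left, norm_neg]
  refine (intervalIntegral.norm_integral_le_of_norm_le_const fun s _ => hC s _).trans ?_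
  gcongr
  rw [abs_of_nonneg (by linarith)]
  linarith

/-- Carathéodory's existence theorem for a bounded field, in integral form. -/
theorem exists_integral_solution [FiniteDimensional ℝ E]
    (hmeas : ∀ u : ℝ → E, StronglyMeasurable u → AEStronglyMeasurable (fun s => g s (u s)))
    (hcont : ∀ s, Continuous (g s)) (hC : ∀ s y, ‖g s y‖ ≤ C) (t₀ : ℝ) (x₀ : E) :
    ∃ x : ℝ → E, LipschitzWith C.toNNReal x ∧
      ∀ t, t₀ ≤ t → x t = x₀ + ∫ s in t₀..t, g s (x s) := by
  have : ProperSpace E := FiniteDimensional.proper ℝ E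
  have hC0 : 0 ≤ C := (norm_nonneg _).trans (hC 0 0)
  choose u hum hu using fun n : ℕ =>
    exists_euler_polygon hmeas hC t₀ x₀ (h := 1 / ((n : ℝ) + 1)) (by positivity)
  have hint : ∀ v : ℝ → E, StronglyMeasurable v → ∀ a b,
      IntervalIntegrable (fun s => g s (v s)) volume a b := fun v hv =>
    intervalIntegrable_of_norm_le (hmeas v hv) fun s => hC s _
  have hlip : ∀ n, LipschitzWith C.toNNReal fun t => x₀ + ∫ s in t₀..t, g s (u n s) := by
    intro n
    refine .of_dist_le_mul fun a b => ?_
    rw [Real.coe_toNNReal _ hC0, dist_add_left, dist_eq_norm,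
      intervalIntegral.integral_interval_sub_left (hint _ (hum n) _ _) (hint _ (hum n) _ _),
      Real.dist_eq]
    exact intervalIntegral.norm_integral_le_of_norm_le_const fun s _ => hC s _
  obtain ⟨φ, x, hφ, hx⟩ := exists_subseq_tendsto_of_lipschitz hlip (t₀ := t₀) (x₀ := x₀)
    (fun n => by simp)
  have hxl : LipschitzWith C.toNNReal x :=
    .of_dist_le_mul fun a b => le_of_tendsto ((hx a).dist (hx b))
      (.of_forall fun n => (hlip (φ n)).dist_le_mul a b)
  have hux : ∀ t, t₀ ≤ t → Tendsto (fun n => u (φ n) t) atTop (𝓝 (x t)) := by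
    intro t ht
    have h0 : Tendsto (fun n : ℕ => C * (1 / (((φ n : ℕ) : ℝ) + 1))) atTop (𝓝 0) := by
      simpa using (tendsto_one_div_add_atTop_nhds_zero_nat.comp hφ.tendsto_atTop).const_mul C
    have h1 := squeeze_zero_norm (fun n => hu (φ n) t ht) h0
    simpa using h1.add (hx t)
  refine ⟨x, hxl, fun t ht => tendsto_nhds_unique (hx t) (.const_add _ ?_)⟩
  refine intervalIntegral.tendsto_integral_filter_of_dominated_convergence (fun _ => C)
    (.of_forall fun n => (hmeas _ (hum _)).restrict)
    (.of_forall fun n => .of_forall fun s _ => hC s _) (by simp) (.of_forall fun s hs => ?_)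
  rw [uIoc_of_le ht] at hs
  exact ((hcont s).tendsto _).comp (hux s hs.1.le)

theorem exists_caratheodory_solution [FiniteDimensional ℝ E]
    (hmeas : ∀ u : ℝ → E, StronglyMeasurable u → AEStronglyMeasurable (fun s => g s (u s)))
    (hcont : ∀ s, Continuous (g s)) (hC : ∀ s y, ‖g s y‖ ≤ C) (t₀ : ℝ) (x₀ : E) :
    ∃ x : ℝ → E, LipschitzWith C.toNNReal x ∧ x t₀ = x₀ ∧
      ∀ᵐ t, t₀ < t → HasDerivAt x (g t (x t)) t := by
  have : CompleteSpace E := FiniteDimensional.complete ℝ E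
  obtain ⟨x, hx, heq⟩ := exists_integral_solution hmeas hcont hC t₀ x₀
  have hxm : StronglyMeasurable x := hx.continuous.stronglyMeasurable
  have hloc : LocallyIntegrable (fun s => g s (x s)) volume :=
    (locallyIntegrable_const C).mono (hmeas x hxm)
      (.of_forall fun s => (hC s _).trans (le_abs_self C))
  refine ⟨x, hx, by simp [heq t₀ le_rfl], ?_⟩
  filter_upwards [LocallyIntegrable.ae_hasDerivAt_integral hloc] with t ht hlt
  refine ((ht t₀).const_add x₀).congr_of_eventuallyEq ?_
  filter_upwards [Ioi_mem_nhds hlt] with s hs using heq s (le_of_lt hs)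

end Peano

/-! ### Retraction onto a ball -/

section Retraction

variable {E : Type*} [NormedAddCommGroup E] [InnerProductSpace ℝ E]

/-- The radial retraction of the space onto the closed ball of radius `R` around `z`. -/
noncomputable def ballRetraction (z : E) (R : ℝ) (y : E) : E :=
  z + (R / max R ‖y - z‖) • (y - z)

variable {z y : E} {R : ℝ}

theorem continuous_ballRetraction (hR : 0 < R) : Continuous (ballRetraction z R) := by
  unfold ballRetraction
  refine continuous_const.add (.smul (.div continuous_const (by fun_prop) fun y => ?_)
    (by fun_prop))
  exact (hR.trans_le (le_max_left _ _)).ne'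

theorem norm_ballRetraction_sub_le (hR : 0 < R) : ‖ballRetraction z R y - z‖ ≤ R := by
  have hm : 0 < max R ‖y - z‖ := hR.trans_le (le_max_left _ _)
  rw [ballRetraction, add_sub_cancel_left, norm_smul, Real.norm_of_nonneg (by positivity),
    div_mul_eq_mul_div, div_le_iff₀ hm]
  gcongr
  exact le_max_right _ _

theorem ballRetraction_of_le (hR : 0 < R) (hy : ‖y - z‖ ≤ R) : ballRetraction z R y = y := by
  rw [ballRetraction, max_eq_left hy, div_self hR.ne', one_smul, add_sub_cancel]

theorem ballRetraction_sub_of_ge (hy : R ≤ ‖y - z‖) :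
    ballRetraction z R y - z = (R / ‖y - z‖) • (y - z) := by
  rw [ballRetraction, max_eq_right hy, add_sub_cancel_left]

/-- Outside the ball, the retracted point is at least as far out in the direction of `y - z` as any
point of the ball. -/
theorem inner_ballRetraction_sub_nonpos (hR : 0 < R) (hy : R ≤ ‖y - z‖) (w : E) :
    inner ℝ (ballRetraction z R w - ballRetraction z R y) (y - z) ≤ 0 := by
  have hpos : 0 < ‖y - z‖ := hR.trans_le hy
  have h1 : inner ℝ (ballRetraction z R y - z) (y - z) = R * ‖y - z‖ := by
    rw [ballRetraction_sub_of_ge hy, inner_smul_left, real_inner_self_eq_norm_sq]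
    simp only [conj_trivial]
    field_simp
  have h2 : inner ℝ (ballRetraction z R w - z) (y - z) ≤ R * ‖y - z‖ :=
    (real_inner_le_norm _ _).trans (by gcongr; exact norm_ballRetraction_sub_le hR)
  rw [← sub_sub_sub_cancel_right _ _ z, inner_sub_left]
  linarith

end Retraction

/-! ### Points determined by their distances -/

section CommonLimit

variable {E : Type*} [NormedAddCommGroup E] [InnerProductSpace ℝ E]

/-- Two points with equal distances to all points of a set with nonempty interior coincide. -/
theorem eq_of_forall_norm_sub_sq_eq {Z : Set E} (hZ : (interior Z).Nonempty) {p q : E}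
    (h : ∀ w ∈ Z, ‖p - w‖ ^ 2 = ‖q - w‖ ^ 2) : p = q := by
  obtain ⟨z₀, hz₀⟩ := hZ
  obtain ⟨s, hsZ, hs⟩ : ∃ s : ℝ, z₀ + s • (q - p) ∈ Z ∧ s ≠ 0 := by
    have hcont : Tendsto (fun s : ℝ => z₀ + s • (q - p)) (𝓝[≠] 0) (𝓝 z₀) := by
      have : Continuous fun s : ℝ => z₀ + s • (q - p) := by fun_prop
      simpa using (this.tendsto 0).mono_left nhdsWithin_le_nhds
    have := (hcont.eventually (mem_interior_iff_mem_nhds.1 hz₀)).and self_mem_nhdsWithin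
    exact this.exists
  have h0 := h z₀ (interior_subset hz₀)
  have h1 := h _ hsZ
  rw [← sub_sub, ← sub_sub, norm_sub_sq_real (p - z₀), norm_sub_sq_real (q - z₀),
    inner_smul_right, inner_smul_right, h0] at h1
  have h2 : s * inner ℝ (q - p) (q - p) = 0 := by
    have : q - p = (q - z₀) - (p - z₀) := by abel
    nth_rewrite 1 [this]
    rw [inner_sub_left]
    linarith
  have h3 := (mul_eq_zero.1 h2).resolve_left hs
  exact (sub_eq_zero.1 (inner_self_eq_zero.1 h3)).symm

/-- If the distances of all `x i` to each point of a set with interior have a limit that does not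
depend on `i`, then all `x i` converge to one point: their cluster points have the same distances
to the points of the set. -/
theorem exists_common_tendsto [FiniteDimensional ℝ E] {ι : Type*} [Nonempty ι] {Z : Set E}
    (hZ : (interior Z).Nonempty) {x : ι → ℝ → E}
    (h : ∀ w ∈ Z, ∃ L, ∀ i, Tendsto (fun t => ‖x i t - w‖ ^ 2) atTop (𝓝 L)) :
    ∃ p, ∀ i, Tendsto (x i) atTop (𝓝 p) := by
  have : ProperSpace E := FiniteDimensional.proper ℝ E
  have hcl : ∀ i q, MapClusterPt q atTop (x i) → ∀ w L,
      Tendsto (fun t => ‖x i t - w‖ ^ 2) atTop (𝓝 L) → ‖q - w‖ ^ 2 = L := by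
    intro i q hq w L hL
    have hcont : Continuous fun y : E => ‖y - w‖ ^ 2 := by fun_prop
    have h1 : MapClusterPt (‖q - w‖ ^ 2) atTop ((fun y => ‖y - w‖ ^ 2) ∘ x i) :=
      hq.continuousAt_comp hcont.continuousAt
    exact eq_of_nhds_neBot (ClusterPt.mono h1 hL)
  obtain ⟨z₀, hz₀⟩ := hZ
  obtain ⟨L, hL⟩ := h z₀ (interior_subset hz₀)
  have hball : ∀ i, ∀ᶠ t in atTop, x i t ∈ Metric.closedBall z₀ (|L| + 1) := by
    intro i
    filter_upwards [(hL i).eventually (gt_mem_nhds (lt_add_one L))] with t ht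
    rw [mem_closedBall_iff_norm]
    have h1 := norm_nonneg (x i t - z₀)
    have h2 := le_abs_self L
    have h3 := abs_nonneg L
    nlinarith
  have i₀ := Classical.arbitrary ι
  obtain ⟨p, -, hp⟩ := (isCompact_closedBall z₀ (|L| + 1)).exists_mapClusterPt
    (tendsto_principal.2 (hball i₀))
  refine ⟨p, fun i => (isCompact_closedBall z₀ (|L| + 1)).tendsto_nhds_of_unique_mapClusterPt
    (hball i) fun q _ hq => eq_of_forall_norm_sub_sq_eq ⟨z₀, hz₀⟩ fun w hw => ?_⟩
  obtain ⟨L', hL'⟩ := h w hw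
  rw [hcl i q hq w L' (hL' i), hcl i₀ p hp w L' (hL' i₀)]

end CommonLimit

/-! ### The network dynamics -/

section Network

variable {ι : Type*} [Fintype ι] {E : Type*} [NormedAddCommGroup E] [InnerProductSpace ℝ E]

/-- The network vector field with weights `b`: an absent arc has weight `0`, so that the sum runs
over all nodes. -/
def networkField (f : ι → E → E) (b : ι → ι → ℝ → ℝ) (t : ℝ) (y : ι → E) (i : ι) : E :=
  f i (y i) + ∑ j, b i j t • (y j - y i)

variable {f : ι → E → E} {b : ι → ι → ℝ → ℝ} {B : ℝ} {z : E}

theorem IsBoundedWeights.le (hb : IsBoundedWeights b B) (i j : ι) (t : ℝ) : b i j t ≤ B :=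
  (Finset.single_le_sum (f := fun j => b i j t) (fun k _ => hb.nonneg i k t)
    (Finset.mem_univ j)).trans (hb.sum_le i t)

theorem IsBoundedWeights.norm_coupling_le (hb : IsBoundedWeights b B) (i : ι) (t : ℝ)
    (w : ι → E) : ‖∑ j, b i j t • w j‖ ≤ B * ∑ j, ‖w j‖ := by
  rw [Finset.mul_sum]
  refine norm_sum_le_of_le _ fun j _ => ?_
  rw [norm_smul, Real.norm_of_nonneg (hb.nonneg i j t)]
  gcongr
  exact hb.le i j t

theorem exists_networkField_bound [FiniteDimensional ℝ E] (hf : ∀ i, Continuous (f i))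
    (hb : IsBoundedWeights b B) (z : E) (R : ℝ) :
    ∃ C, 0 ≤ C ∧ ∀ t y, (∀ i, ‖y i - z‖ ≤ R) → ∀ i, ‖networkField f b t y i‖ ≤ C := by
  have : ProperSpace E := FiniteDimensional.proper ℝ E
  choose c hc using fun i =>
    (isCompact_closedBall z R).exists_bound_of_continuousOn (hf i).continuousOn
  refine ⟨∑ i, |c i| + B * ∑ _j : ι, |R + R|, ?_, fun t y hy i => ?_⟩
  · have := hb.bound_nonneg
    positivity
  have hball : y i ∈ Metric.closedBall z R := by
    rw [mem_closedBall_iff_norm]; exact hy i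
  refine norm_add_le_of_le ?_ ((hb.norm_coupling_le i t fun j => y j - y i).trans ?_)
  · exact ((hc i _ hball).trans (le_abs_self _)).trans
      (Finset.single_le_sum (f := fun i => |c i|) (fun j _ => abs_nonneg _) (Finset.mem_univ i))
  · refine mul_le_mul_of_nonneg_left (Finset.sum_le_sum fun j _ => ?_) hb.bound_nonneg
    refine le_trans ?_ (le_abs_self _)
    rw [← sub_sub_sub_cancel_right _ _ z]
    exact norm_sub_le_of_le (hy j) (hy i)

/-- Every initial value starts a global solution. The field composed with the retraction onto a
ball around `z` is bounded, hence has a solution; its distances to `z` cannot leave the ball, where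
retracting changes nothing. -/
theorem exists_network_solution [FiniteDimensional ℝ E] (hf : ∀ i, Continuous (f i))
    (hz : ∀ i y, inner ℝ (f i y) (y - z) ≤ 0) (hb : IsBoundedWeights b B)
    (hbm : ∀ i j, AEMeasurable (b i j)) (t₀ : ℝ) (x₀ : ι → E) :
    ∃ x : ι → ℝ → E, (∀ i, ∃ C, LipschitzWith C (x i)) ∧ (∀ i, x i t₀ = x₀ i) ∧
      ∀ᵐ t, t₀ < t → ∀ i, HasDerivAt (x i) (networkField f b t (fun j => x j t) i) t := by
  borelize E
  set R := 1 + ∑ i, ‖x₀ i - z‖ with hRdef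
  have hsum : 0 ≤ ∑ i, ‖x₀ i - z‖ := by positivity
  have hR : 0 < R := by linarith
  have hx₀ : ∀ i, ‖x₀ i - z‖ ≤ R := fun i => by
    have := Finset.single_le_sum (f := fun i => ‖x₀ i - z‖) (fun j _ => norm_nonneg _)
      (Finset.mem_univ i)
    linarith
  let g : ℝ → (ι → E) → ι → E := fun t y => networkField f b t fun j => ballRetraction z R (y j)
  have hret : Continuous (ballRetraction z R) := continuous_ballRetraction hR
  obtain ⟨C, hC0, hC⟩ := exists_networkField_bound hf hb z R
  have hgC : ∀ s y, ‖g s y‖ ≤ C := fun s y =>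
    (pi_norm_le_iff_of_nonneg hC0).2 (hC s _ fun i => norm_ballRetraction_sub_le hR)
  have hgcont : ∀ s, Continuous (g s) := fun s => by
    refine continuous_pi fun i => ?_
    simp only [g, networkField]
    fun_prop
  have hgm : ∀ u : ℝ → ι → E, StronglyMeasurable u →
      AEStronglyMeasurable (fun s => g s (u s)) := by
    intro u hu
    have hP : ∀ i, StronglyMeasurable fun s => ballRetraction z R (u s i) := fun i =>
      hret.comp_stronglyMeasurable ((continuous_apply i).comp_stronglyMeasurable hu)
    have : SecondCountableTopology E := by
      have := FiniteDimensional.proper ℝ E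
      infer_instance
    refine AEMeasurable.aestronglyMeasurable (aemeasurable_pi_lambda _ fun i => ?_)
    refine AEStronglyMeasurable.aemeasurable (.add
      ((hf i).comp_stronglyMeasurable (hP i)).aestronglyMeasurable
      (Finset.aestronglyMeasurable_fun_sum _ fun j _ => ?_))
    exact (hbm i j).aestronglyMeasurable.smul ((hP j).sub (hP i)).aestronglyMeasurable
  obtain ⟨x, hx, hxt, hode⟩ := exists_caratheodory_solution hgm hgcont hgC t₀ x₀
  have hlip : ∀ i, LipschitzWith C.toNNReal fun t => x t i := fun i =>
    .of_dist_le_mul fun s t => (dist_le_pi_dist (x s) (x t) i).trans (hx.dist_le_mul s t)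
  have hstay : ∀ t, t₀ ≤ t → ∀ i, ‖x t i - z‖ ≤ R := by
    intro t ht i
    have hac : AbsolutelyContinuousOnInterval (fun t => x t i) t₀ t :=
      (hlip i).lipschitzOnWith.absolutelyContinuousOnInterval
    suffices hsq : ‖x t i - z‖ ^ 2 ≤ R ^ 2 from (sq_le_sq₀ (norm_nonneg _) hR.le).1 hsq
    refine AbsolutelyContinuousOnInterval.le_of_deriv_nonpos_of_ge
      (φ := fun t => ‖x t i - z‖ ^ 2) ht (hac.norm_sub_sq z) ?_ ?_
    · rw [hxt]
      have := hx₀ i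
      gcongr
    · filter_upwards [hode] with s hs hm hge
      have hd : HasDerivAt (fun t => x t i) (g s (x s) i) s := hasDerivAt_pi.1 (hs hm.1) i
      refine ⟨_, (hd.sub_const z).norm_sq, ?_⟩
      have hge' : R ≤ ‖x s i - z‖ := (sq_le_sq₀ hR.le (norm_nonneg _)).1 hge
      have hpos : 0 < ‖x s i - z‖ := hR.trans_le hge'
      have h1 : inner ℝ (f i (ballRetraction z R (x s i))) (x s i - z) ≤ 0 := by
        have h2 := hz i (ballRetraction z R (x s i))
        rw [ballRetraction_sub_of_ge hge', inner_smul_right] at h2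
        exact nonpos_of_mul_nonpos_right h2 (div_pos hR hpos)
      have h3 : inner ℝ (∑ j, b i j s • (ballRetraction z R (x s j) - ballRetraction z R (x s i)))
          (x s i - z) ≤ 0 := by
        rw [sum_inner]
        refine Finset.sum_nonpos fun j _ => ?_
        rw [real_inner_smul_left]
        exact mul_nonpos_of_nonneg_of_nonpos (hb.nonneg i j s)
          (inner_ballRetraction_sub_nonpos hR hge' _)
      have h4 : inner ℝ (x s i - z) (g s (x s) i) ≤ 0 := by
        rw [real_inner_comm]
        simp only [g, networkField, inner_add_left]
        linarith
      linarith
  refine ⟨fun i t => x t i, fun i => ⟨_, hlip i⟩, congrFun hxt, ?_⟩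
  filter_upwards [hode] with t ht hlt i
  have hd : HasDerivAt (fun t => x t i) (g t (x t) i) t := hasDerivAt_pi.1 (ht hlt) i
  have : (fun j => ballRetraction z R (x t j)) = fun j => x t j :=
    funext fun j => ballRetraction_of_le hR (hstay t hlt.le j)
  simpa only [g, this] using hd

/-- The squared distances of the node states to a common zero `z` form a subsolution of the scalar
consensus equation, since `2 ⟪p, q - p⟫ ≤ ‖q‖ ^ 2 - ‖p‖ ^ 2`. -/
theorem isConsensusSubsolution_norm_sub_sq {x : ι → ℝ → E} {t₀ t₁ : ℝ}
    (hz : ∀ i y, inner ℝ (f i y) (y - z) ≤ 0) (hb : IsBoundedWeights b B)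
    (hac : ∀ i, AbsolutelyContinuousOnInterval (x i) t₀ t₁)
    (hode : ∀ᵐ t, t ∈ Ioo t₀ t₁ →
      ∀ i, HasDerivAt (x i) (networkField f b t (fun j => x j t) i) t) :
    IsConsensusSubsolution b t₀ t₁ fun i t => ‖x i t - z‖ ^ 2 where
  ac i := (hac i).norm_sub_sq z
  deriv_le := by
    filter_upwards [hode] with t ht hm i
    refine ⟨_, ((ht hm i).sub_const z).norm_sq, ?_⟩
    rw [real_inner_comm, networkField, inner_add_left, sum_inner]
    have h1 : ∀ j, 2 * inner ℝ (b i j t • (x j t - x i t)) (x i t - z) ≤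
        b i j t * (‖x j t - z‖ ^ 2 - ‖x i t - z‖ ^ 2) := by
      intro j
      rw [real_inner_smul_left, mul_left_comm]
      refine mul_le_mul_of_nonneg_left ?_ (hb.nonneg i j t)
      have h2 : x j t - z = (x j t - x i t) + (x i t - z) := by abel
      have h3 := norm_add_sq_real (x j t - x i t) (x i t - z)
      rw [← h2] at h3
      nlinarith [sq_nonneg ‖x j t - x i t‖]
    have h4 := Finset.sum_le_sum fun j (_ : j ∈ Finset.univ) => h1 j
    rw [← Finset.mul_sum] at h4
    linarith [hz i (x i t)]

/-- A solution on `[0, T)` extends to `[0, ∞)`: by the maximum principle it is bounded, hence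
Lipschitz, so it has a limit at `T`, from which a global solution starts. -/
theorem exists_network_extension [FiniteDimensional ℝ E] (hf : ∀ i, Continuous (f i))
    (hz : ∀ i y, inner ℝ (f i y) (y - z) ≤ 0) (hb : IsBoundedWeights b B)
    (hbm : ∀ i j, AEMeasurable (b i j)) {T : ℝ} {y : ι → ℝ → E}
    (hac : ∀ t ∈ Ico 0 T, ∀ i, AbsolutelyContinuousOnInterval (y i) 0 t)
    (hode : ∀ᵐ t, t ∈ Ioo 0 T →
      ∀ i, HasDerivAt (y i) (networkField f b t (fun j => y j t) i) t) :
    ∃ x : ι → ℝ → E, (∀ i, ∃ C, LipschitzWith C (x i)) ∧ (∀ t ∈ Ico 0 T, ∀ i, x i t = y i t) ∧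
      ∀ᵐ t, 0 < t → ∀ i, HasDerivAt (x i) (networkField f b t (fun j => x j t) i) t := by
  set R := ∑ i, ‖y i 0 - z‖ with hR
  have hR0 : 0 ≤ R := by positivity
  have hbdd : ∀ t ∈ Ico 0 T, ∀ i, ‖y i t - z‖ ≤ R := by
    intro t ht i
    have hsub := isConsensusSubsolution_norm_sub_sq hz hb (hac t ht) (by
      filter_upwards [hode] with s hs hm using hs ⟨hm.1, hm.2.trans ht.2⟩)
    refine (sq_le_sq₀ (norm_nonneg _) hR0).1 (hsub.le_of_le hb (fun j => ?_) ⟨ht.1, le_rfl⟩ i)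
    have := Finset.single_le_sum (f := fun i => ‖y i 0 - z‖) (fun j _ => norm_nonneg _)
      (Finset.mem_univ j)
    gcongr
  obtain ⟨C, hC0, hC⟩ := exists_networkField_bound hf hb z R
  have hylip : ∀ i, LipschitzOnWith C.toNNReal (y i) (Ico 0 T) := by
    intro i
    have hmain : ∀ s ∈ Ico 0 T, ∀ t ∈ Ico 0 T, s ≤ t → dist (y i s) (y i t) ≤ C * dist s t := by
      intro s hs t ht hst
      rw [dist_comm, dist_eq_norm, dist_comm, Real.dist_eq, abs_of_nonneg (sub_nonneg.2 hst)]
      refine AbsolutelyContinuousOnInterval.norm_sub_le hst hC0 ((hac t ht i).mono ?_) ?_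
      · rw [uIcc_of_le hst, uIcc_of_le ht.1]
        exact Icc_subset_Icc hs.1 le_rfl
      · filter_upwards [hode] with r hr hm
        have hrT : r ∈ Ioo 0 T := ⟨hs.1.trans_lt hm.1, hm.2.trans ht.2⟩
        exact ⟨_, hr hrT i, hC r _ (hbdd r ⟨hrT.1.le, hrT.2⟩) i⟩
    refine .of_dist_le_mul fun s hs t ht => ?_
    rw [Real.coe_toNNReal _ hC0]
    rcases le_total s t with hst | hst
    · exact hmain s hs t ht hst
    · rw [dist_comm (y i s), dist_comm s]
      exact hmain t ht s hs hst
  choose Y hY hYy using fun i => (hylip i).extend_finite_dimension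
  obtain ⟨x, hx, hxT, hxode⟩ := exists_network_solution hf hz hb hbm T fun i => Y i T
  choose c hc using hx
  -- gluing by a sum of Lipschitz functions, each constant on one side of `T`
  refine ⟨fun i t => Y i (min t T) + x i (max t T) - Y i T, fun i => ⟨_, (LipschitzWith.add
    ((hY i).comp (LipschitzWith.id.min_const T)) ((hc i).comp (LipschitzWith.id.max_const T))).sub
    (.const (Y i T))⟩, fun t ht i => ?_, ?_⟩
  · simp only [min_eq_left ht.2.le, max_eq_right ht.2.le, hxT, add_sub_cancel_right]
    exact (hYy i ht).symm
  have hlow : ∀ i, ∀ t ∈ Ioo 0 T, Y i (min t T) + x i (max t T) - Y i T = y i t := by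
    intro i t ht
    rw [min_eq_left ht.2.le, max_eq_right ht.2.le, hxT, add_sub_cancel_right]
    exact (hYy i ⟨ht.1.le, ht.2⟩).symm
  have hupp : ∀ i, ∀ t ∈ Ioi T, Y i (min t T) + x i (max t T) - Y i T = x i t := by
    intro i t ht
    rw [min_eq_right (le_of_lt ht), max_eq_left (le_of_lt ht), add_sub_cancel_left]
  have hne : ∀ᵐ t : ℝ, t ≠ T := by simp [ae_iff]
  filter_upwards [hode, hxode, hne] with t h1 h2 h3 hpos i
  rcases h3.lt_or_gt with hlt | hgt
  · have : (fun j => Y j (min t T) + x j (max t T) - Y j T) = fun j => y j t :=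
      funext fun j => hlow j t ⟨hpos, hlt⟩
    rw [this]
    exact (h1 ⟨hpos, hlt⟩ i).congr_of_eventuallyEq
      (by filter_upwards [Ioo_mem_nhds hpos hlt] with s hs using hlow i s hs)
  · have : (fun j => Y j (min t T) + x j (max t T) - Y j T) = fun j => x j t :=
      funext fun j => hupp j t hgt
    rw [this]
    exact (h2 hgt i).congr_of_eventuallyEq
      (by filter_upwards [Ioi_mem_nhds hgt] with s hs using hupp i s hs)

/-- A common limit of all nodes is a zero of every `f i`: the coupling vanishes in the limit, so
`x i` would otherwise drift with velocity close to `f i p`. -/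
theorem eq_zero_of_tendsto {x : ι → ℝ → E} (hf : ∀ i, Continuous (f i))
    (hb : IsBoundedWeights b B)
    (hac : ∀ t, 0 ≤ t → ∀ i, AbsolutelyContinuousOnInterval (x i) 0 t)
    (hode : ∀ᵐ t, 0 < t → ∀ i, HasDerivAt (x i) (networkField f b t (fun j => x j t) i) t)
    {p : E} (hx : ∀ i, Tendsto (x i) atTop (𝓝 p)) (i : ι) : f i p = 0 := by
  by_contra hne
  set e := f i p with he
  have hpos : 0 < ‖e‖ ^ 2 := by positivity
  have hlim : Tendsto (fun t => inner ℝ e (f i (x i t)) - ‖e‖ * (B * ∑ j, ‖x j t - x i t‖)) atTop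
      (𝓝 (‖e‖ ^ 2)) := by
    have h1 : Tendsto (fun t => ∑ j, ‖x j t - x i t‖) atTop (𝓝 0) := by
      simpa using tendsto_finsetSum Finset.univ fun j _ => ((hx j).sub (hx i)).norm
    have h2 := (tendsto_const_nhds (x := e)).inner (𝕜 := ℝ) (((hf i).tendsto p).comp (hx i))
    rw [← he, real_inner_self_eq_norm_sq] at h2
    simpa using h2.sub ((h1.const_mul B).const_mul ‖e‖)
  have hinner : Tendsto (fun t => inner ℝ e (x i t)) atTop (𝓝 (inner ℝ e p)) :=
    tendsto_const_nhds.inner (hx i)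
  have hdiff := ((hinner.comp (tendsto_atTop_add_const_right _ 1 tendsto_id)).sub hinner)
  rw [sub_self] at hdiff
  obtain ⟨t₁, ht₁⟩ := eventually_atTop.1 (hlim.eventually (lt_mem_nhds (half_lt_self hpos)))
  obtain ⟨t, ht, h0, hlt⟩ := ((eventually_ge_atTop t₁).and ((eventually_ge_atTop 0).and
    (hdiff.eventually (gt_mem_nhds (half_pos hpos))))).exists
  have hac' : AbsolutelyContinuousOnInterval (x i) t (t + 1) := (hac (t + 1) (by linarith) i).mono
    (by rw [uIcc_of_le (by linarith), uIcc_of_le (by linarith)]; exact Icc_subset_Icc h0 le_rfl)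
  have key := (hac'.inner_const e).mul_sub_le_sub (c := ‖e‖ ^ 2 / 2) (by linarith) (by
    filter_upwards [hode] with s hs hm
    refine ⟨_, (innerSL ℝ e).hasFDerivAt.comp_hasDerivAt s (hs (h0.trans_lt hm.1) i), ?_⟩
    have h1 := ht₁ s (ht.trans hm.1.le)
    have h2 := hb.norm_coupling_le i s fun j => x j s - x i s
    have h3 := (abs_le.1 (abs_real_inner_le_norm e (∑ j, b i j s • (x j s - x i s)))).1
    have h4 := mul_le_mul_of_nonneg_left h2 (norm_nonneg e)
    simp only [networkField, innerSL_apply_apply, inner_add_right]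
    linarith)
  simp only [Function.comp_apply, id] at hlt
  linarith

end Network

/-! ### Gradients of convex functions -/

/-- The first-order condition for convexity along a segment. -/
theorem ConvexOn.inner_gradient_sub_le {E : Type*} [NormedAddCommGroup E] [InnerProductSpace ℝ E]
    [CompleteSpace E] {F : E → ℝ} (hF : ConvexOn ℝ univ F) {x : E} (hx : DifferentiableAt ℝ F x)
    (z : E) : inner ℝ (gradient F x) (z - x) ≤ F z - F x := by
  have hconv : ConvexOn ℝ univ (F ∘ AffineMap.lineMap (k := ℝ) x z) := by
    simpa using hF.comp_affineMap (AffineMap.lineMap (k := ℝ) x z)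
  have hF' : HasFDerivAt F (fderiv ℝ F x) (AffineMap.lineMap x z (0 : ℝ)) := by
    simpa using hx.hasFDerivAt
  have h1 := hconv.le_slope_of_hasDerivAt (mem_univ (0 : ℝ)) (mem_univ 1) zero_lt_one
    (hF'.comp_hasDerivAt 0 AffineMap.hasDerivAt_lineMap)
  simpa [slope_def_field, inner_gradient_left] using h1

/-- Minus the gradient of a convex function points to the half-space containing each critical
point. -/
theorem inner_neg_gradient_sub_nonpos {E : Type*} [NormedAddCommGroup E] [InnerProductSpace ℝ E]
    [CompleteSpace E] {F : E → ℝ} (hF : ConvexOn ℝ univ F) (hd : Differentiable ℝ F) {z : E}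
    (hz : gradient F z = 0) (y : E) : inner ℝ (-gradient F y) (y - z) ≤ 0 := by
  have h1 := hF.inner_gradient_sub_le (hd y) z
  have h2 := hF.inner_gradient_sub_le (hd z) y
  rw [hz, inner_zero_left] at h2
  rw [← neg_sub y z, inner_neg_right] at h1
  rw [inner_neg_left]
  linarith

theorem ContDiff.continuous_gradient {E : Type*} [NormedAddCommGroup E] [InnerProductSpace ℝ E]
    [CompleteSpace E] {F : E → ℝ} (hF : ContDiff ℝ 1 F) : Continuous (gradient F) :=
  (InnerProductSpace.toDual ℝ E).symm.continuous.comp (hF.continuous_fderiv one_ne_zero)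

/-! ### Switching digraphs with dwell time -/

theorem Relation.ReflTransGen.exists_leaving {α : Type*} {r : α → α → Prop} {p : α → Prop} {a b : α}
    (h : Relation.ReflTransGen r a b) (ha : p a) (hb : ¬p b) : ∃ c d, p c ∧ ¬p d ∧ r c d := by
  induction h with
  | refl => exact absurd ha hb
  | @tail c d _ hcd ih =>
    by_cases hc : p c
    · exact ⟨c, d, hc, hb, hcd⟩
    · exact ih hc

section Switching

theorem exists_mem_Ico_of_dwellTime {s : ℕ → ℝ} {τ : ℝ} (hτ : 0 < τ) (h0 : s 0 = 0)
    (hs : ∀ k, s k + τ ≤ s (k + 1)) {t : ℝ} (ht : 0 ≤ t) : ∃ k, t ∈ Ico (s k) (s (k + 1)) := by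
  have hgrow : ∀ n : ℕ, n * τ ≤ s n := by
    intro n
    induction n with
    | zero => simp [h0]
    | succ n ih =>
      have := hs n
      push_cast
      linarith
  have hmain : ∀ n : ℕ, t < s n → ∃ k, t ∈ Ico (s k) (s (k + 1)) := by
    intro n
    induction n with
    | zero => intro h; linarith
    | succ n ih =>
      intro h
      rcases lt_or_ge t (s n) with h' | h'
      · exact ih h'
      · exact ⟨n, h', h⟩
  obtain ⟨n, hn⟩ := exists_nat_gt (t / τ)
  exact hmain n (((div_lt_iff₀ hτ).1 hn).trans_le (hgrow n))

theorem PiecewiseConstantWithDwellTime.measurableSet_adj {V : Type*} {G : ℝ → Digraph V}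
    (hG : PiecewiseConstantWithDwellTime G) (i j : V) :
    MeasurableSet {t | 0 ≤ t ∧ (G t).Adj i j} := by
  obtain ⟨τ, hτ, s, h0, hs, hconst⟩ := hG
  have hpos : ∀ k, 0 ≤ s k := fun k => by
    induction k with
    | zero => exact h0.ge
    | succ k ih => linarith [hs k]
  have : {t | 0 ≤ t ∧ (G t).Adj i j} =
      ⋃ k ∈ {k | (G (s k)).Adj i j}, Ico (s k) (s (k + 1)) := by
    ext t
    simp only [mem_ofPred_eq, mem_iUnion, exists_prop]
    constructor
    · rintro ⟨ht, hadj⟩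
      obtain ⟨k, hk⟩ := exists_mem_Ico_of_dwellTime hτ h0 hs ht
      exact ⟨k, hconst k t hk ▸ hadj, hk⟩
    · rintro ⟨k, hadj, hk⟩
      exact ⟨(hpos k).trans hk.1, (hconst k t hk).symm ▸ hadj⟩
  rw [this]
  exact .biUnion (to_countable _) fun k _ => measurableSet_Ico

variable {N : ℕ} {K : ℝ} {G : ℝ → Digraph (Fin N)} {a : Fin N → Fin N → ℝ → ℝ}

open Classical in
/-- The weight with which node `j` acts on node `i` at time `t`: `K * a i j t` if the arc `(j, i)`
is present at the time `t ≥ 0`, and `0` otherwise. At negative times, where nothing is assumed of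
`a` and `G`, it is `0`, so that its bounds hold at all times. -/
noncomputable def effectiveWeight (K : ℝ) (G : ℝ → Digraph (Fin N)) (a : Fin N → Fin N → ℝ → ℝ)
    (i j : Fin N) (t : ℝ) : ℝ :=
  if 0 ≤ t ∧ (G t).Adj j i then K * a i j t else 0

theorem couplingField_eq_networkField {m : ℕ}
    (f : Fin N → EuclideanSpace ℝ (Fin m) → EuclideanSpace ℝ (Fin m)) {t : ℝ} (ht : 0 ≤ t) :
    couplingField f K G a t = networkField f (effectiveWeight K G a) t := by
  funext y i
  simp only [couplingField, networkField, effectiveWeight, Finset.smul_sum, Finset.sum_filter]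
  congr 1
  refine Finset.sum_congr rfl fun j _ => ?_
  by_cases hadj : (G t).Adj j i <;> simp [hadj, ht, smul_smul]

theorem exists_isBoundedWeights_effectiveWeight (hK : 0 < K) (ha : AdmissibleWeights G a) :
    ∃ B, IsBoundedWeights (effectiveWeight K G a) B := by
  obtain ⟨-, aLow, aUp, hlow, hbd⟩ := ha
  have hle : ∀ i j t, effectiveWeight K G a i j t ≤ K * |aUp| := by
    intro i j t
    unfold effectiveWeight
    split_ifs with h
    · gcongr
      exact (hbd i j t h.1 h.2).2.trans (le_abs_self _)
    · positivity
  refine ⟨∑ _j : Fin N, K * |aUp|, fun i j t => ?_, fun i t => Finset.sum_le_sum fun j _ =>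
    hle i j t, by positivity⟩
  unfold effectiveWeight
  split_ifs with h
  · exact mul_nonneg hK.le (hlow.le.trans (hbd i j t h.1 h.2).1)
  · exact le_rfl

theorem aemeasurable_effectiveWeight (hG : PiecewiseConstantWithDwellTime G)
    (ha : AdmissibleWeights G a) (i j : Fin N) : AEMeasurable (effectiveWeight K G a i j) := by
  classical
  have hset := hG.measurableSet_adj j i
  have : effectiveWeight K G a i j =
      {t | 0 ≤ t ∧ (G t).Adj j i}.indicator fun t => K * a i j t := by
    funext t
    simp only [effectiveWeight, indicator_apply, mem_ofPred_eq]
  rw [this, aemeasurable_indicator_iff hset]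
  exact ((ha.1 i j).mono_measure (Measure.restrict_mono (fun t ht => ht.1) le_rfl)).const_mul K

/-- Joint strong connectivity makes some arc leave the given set of nodes at some time; the dwell
time keeps that arc present for a time `τ`, for which the window is enlarged by `τ` on both
sides. -/
theorem exists_persistentlyLeaving_effectiveWeight (hK : 0 < K)
    (hG : PiecewiseConstantWithDwellTime G) (ha : AdmissibleWeights G a)
    (hconn : UniformlyJointlyStronglyConnected G) :
    ∃ T τ c, 0 ≤ T ∧ 0 < τ ∧ 0 < c ∧ PersistentlyLeaving (effectiveWeight K G a) T τ c := by
  obtain ⟨τ, hτ, s, h0, hs, hconst⟩ := hG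
  obtain ⟨T, hT, hconn⟩ := hconn
  obtain ⟨-, aLow, aUp, hlow, hbd⟩ := ha
  refine ⟨T + 2 * τ, τ, K * aLow, by positivity, hτ, by positivity, fun t ht S hne huniv => ?_⟩
  obtain ⟨j₀, hj₀⟩ := hne
  obtain ⟨i₀, hi₀⟩ : ∃ i, i ∉ S := by
    by_contra! h
    exact huniv (Finset.eq_univ_iff_forall.2 h)
  obtain ⟨j, i, hj, hi, r, hr, hadj⟩ :=
    (hconn (t + τ) (by linarith) j₀ i₀).exists_leaving (p := (· ∈ S)) hj₀ hi₀
  obtain ⟨k, hk⟩ := exists_mem_Ico_of_dwellTime hτ h0 hs (t := r) (by linarith [hr.1])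
  have hweight : ∀ r' ∈ Ico (s k) (s (k + 1)), 0 ≤ r' →
      K * aLow ≤ effectiveWeight K G a i j r' := by
    intro r' hr' hr0
    have hadj' : (G r').Adj j i := by rwa [hconst k r' hr', ← hconst k r hk]
    rw [effectiveWeight, if_pos ⟨hr0, hadj'⟩]
    gcongr
    exact (hbd i j r' hr0 hadj').1
  have hlast := hs k
  have hr1 := hr.1
  have hr2 := hr.2
  have hk1 := hk.1
  have hk2 := hk.2
  refine ⟨j, hj, i, hi, max (s k) (r - τ), ?_, ?_, fun r' hr' => hweight r' ⟨?_, ?_⟩ ?_⟩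
  · exact le_max_of_le_right (by linarith)
  · rw [← le_sub_iff_add_le]
    exact max_le (by linarith) (by linarith)
  · exact (le_max_left _ _).trans hr'.1.le
  · refine hr'.2.trans_le ?_
    rw [← le_sub_iff_add_le]
    exact max_le (by linarith) (by linarith)
  · linarith [(le_max_right (s k) (r - τ)).trans_lt hr'.1]

end Switching

/-! ### Convergence of the trajectories -/

theorem isCaratheodorySolution_Ici_of_lipschitz {N m : ℕ}
    {f : Fin N → EuclideanSpace ℝ (Fin m) → EuclideanSpace ℝ (Fin m)} {K : ℝ}
    {G : ℝ → Digraph (Fin N)} {a : Fin N → Fin N → ℝ → ℝ}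
    {x : Fin N → ℝ → EuclideanSpace ℝ (Fin m)} (hx : ∀ i, ∃ C, LipschitzWith C (x i))
    (hode : ∀ᵐ t, 0 < t → ∀ i,
      HasDerivAt (x i) (networkField f (effectiveWeight K G a) t (fun j => x j t) i) t) :
    IsCaratheodorySolution f K G a (Ici 0) x := by
  refine ⟨fun T _ i => ?_, ?_⟩
  · obtain ⟨C, hC⟩ := hx i
    exact hC.lipschitzOnWith.absolutelyContinuousOnInterval
  · rw [← restrict_Ioi_eq_restrict_Ici]
    filter_upwards [ae_restrict_of_ae hode, self_mem_ae_restrict measurableSet_Ioi] with t ht hpos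
    rw [couplingField_eq_networkField f (le_of_lt hpos)]
    exact ht hpos

theorem theorem3 {N m : ℕ}
    (f : Fin N → EuclideanSpace ℝ (Fin m) → EuclideanSpace ℝ (Fin m))
    (K : ℝ) (G : ℝ → Digraph (Fin N)) (a : Fin N → Fin N → ℝ → ℝ)
    (hK : 0 < K)
    (hG : PiecewiseConstantWithDwellTime G)
    (ha : AdmissibleWeights G a)
    (hf : IsConvexGradientDynamics f)
    (hconn : UniformlyJointlyStronglyConnected G)
    (hint : (interior (⋂ i, {z | f i z = 0})).Nonempty) :
    -- from every initial value there is a trajectory on the whole of `[0, ∞)`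
    (∀ x₀ : Fin N → EuclideanSpace ℝ (Fin m), ∃ x : Fin N → ℝ → EuclideanSpace ℝ (Fin m),
      IsCaratheodorySolution f K G a (Ici 0) x ∧ ∀ i, x i 0 = x₀ i) ∧
    -- no finite-time escape: a solution on `[0, b)` is part of one on `[0, ∞)`
    (∀ b : ℝ, 0 < b → ∀ y : Fin N → ℝ → EuclideanSpace ℝ (Fin m),
      IsCaratheodorySolution f K G a (Ico 0 b) y →
      ∃ x : Fin N → ℝ → EuclideanSpace ℝ (Fin m),
        IsCaratheodorySolution f K G a (Ici 0) x ∧ ∀ t ∈ Ico 0 b, ∀ i, x i t = y i t) ∧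
    -- global synchronization
    GloballySynchronizes f K G a ∧
    -- convergence of all node states to one common zero
    (∀ x : Fin N → ℝ → EuclideanSpace ℝ (Fin m), IsCaratheodorySolution f K G a (Ici 0) x →
      ∃ xs ∈ ⋂ i, {z | f i z = 0}, ∀ i, Tendsto (x i) atTop (𝓝 xs)) := by
  obtain ⟨F, hF⟩ := hf
  have hcont : ∀ i, Continuous (f i) := fun i => by
    rw [funext (hF i).2.2.2]
    exact (hF i).1.continuous_gradient.neg
  have hmono : ∀ z ∈ ⋂ i, {z | f i z = 0}, ∀ i y, inner ℝ (f i y) (y - z) ≤ 0 := by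
    intro z hz i y
    have hzi : f i z = 0 := mem_iInter.1 hz i
    rw [(hF i).2.2.2] at hzi ⊢
    exact inner_neg_gradient_sub_nonpos (hF i).2.1 ((hF i).1.differentiable one_ne_zero)
      (neg_eq_zero.1 hzi) y
  obtain ⟨B, hb⟩ := exists_isBoundedWeights_effectiveWeight hK ha
  have hbm := aemeasurable_effectiveWeight (K := K) hG ha
  obtain ⟨T, τ, c, hT, hτ, hc, hleave⟩ := exists_persistentlyLeaving_effectiveWeight hK hG ha hconn
  obtain ⟨z, hz⟩ := hint.mono interior_subset
  have hconv : ∀ x : Fin N → ℝ → EuclideanSpace ℝ (Fin m),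
      IsCaratheodorySolution f K G a (Ici 0) x →
      ∃ xs ∈ ⋂ i, {z | f i z = 0}, ∀ i, Tendsto (x i) atTop (𝓝 xs) := by
    intro x hx
    rcases isEmpty_or_nonempty (Fin N) with hN | hN
    · exact ⟨z, hz, fun i => hN.elim i⟩
    have hode : ∀ᵐ t, 0 < t → ∀ i,
        HasDerivAt (x i) (networkField f (effectiveWeight K G a) t (fun j => x j t) i) t := by
      filter_upwards [ae_imp_of_ae_restrict hx.2] with t ht hpos
      rw [← couplingField_eq_networkField f hpos.le]
      exact ht (mem_Ici.2 hpos.le)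
    obtain ⟨p, hp⟩ := exists_common_tendsto hint fun w hw =>
      exists_tendsto_of_consensusSubsolution (v := fun i t => ‖x i t - w‖ ^ 2) hT hτ hc hleave hb
        (fun t ht => isConsensusSubsolution_norm_sub_sq (hmono w hw) hb (hx.1 t ht) (by
          filter_upwards [hode] with s hs hm using hs hm.1)) fun i t => sq_nonneg _
    exact ⟨p, mem_iInter.2 fun i => eq_zero_of_tendsto hcont hb hx.1 hode hp i, hp⟩
  refine ⟨fun x₀ => ?_, fun b _ y hy => ?_, fun x hx i j => ?_, hconv⟩
  · obtain ⟨x, hx, hx₀, hode⟩ := exists_network_solution hcont (hmono z hz) hb hbm 0 x₀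
    exact ⟨x, isCaratheodorySolution_Ici_of_lipschitz hx hode, hx₀⟩
  · obtain ⟨x, hx, hxy, hode⟩ := exists_network_extension hcont (hmono z hz) hb hbm hy.1 (by
      filter_upwards [ae_imp_of_ae_restrict hy.2] with t ht hm
      rw [← couplingField_eq_networkField f hm.1.le]
      exact ht ⟨hm.1.le, hm.2⟩)
    exact ⟨x, isCaratheodorySolution_Ici_of_lipschitz hx hode, hxy⟩
  · obtain ⟨p, -, hp⟩ := hconv x hx
    simpa using ((hp i).sub (hp j)).norm
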